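/- Let $\mathcal H$ be a complex Hilbert space and let $A$ be a bounded linear operator on $\mathcal H$. Write $\|A\|$ for the operator norm, $w(A)=\sup\{|\langle Ax,x\rangle| : x\in\mathcal H,\ \|x\|=1\}$ for the numerical radius (with $w(A)=0$ if $\mathcal H=\{0\}$), $|A|=(A^*A)^{1/2}$ and $|A^*|=(AA^*)^{1/2}$; real powers of positive operators are taken by the continuous functional calculus, so the zeroth power is the identity, and $0^0=1$. For $t\in[0,1]$ put $$\beta_A(t)=\|A\|^{t}\,\left\|\tfrac12\left(|A|^{1-t}+|A^*|^{1-t}\right)\right\| .$$ Then $$w(A)\le \beta_A(t)\le \|A\|\qquad\text{for all } t\in[0,1].$$ Moreover, $\min_{t\in[0,1]}\beta_A(t)$ exists and $$w(A)\le \min_{t\in[0,1]}\beta_A(t)\le \|A\|^{1/2}\left\|\tfrac12\left(|A|^{1/2}+|A^*|^{1/2}\right)\right\| .$$ -/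

import Mathlib

/-- The numerical radius `w(A) = sup { |⟨A x, x⟩| : ‖x‖ = 1 }` of a bounded operator on a complex
Hilbert space. The set is bounded above by `‖A‖` (see `bddAbove_numericalRadius`); on the zero
space it is empty and the value is `0`. -/
noncomputable def numericalRadius {H : Type*} [NormedAddCommGroup H] [InnerProductSpace ℂ H]
    (A : H →L[ℂ] H) : ℝ :=
  sSup {r : ℝ | ∃ x : H, ‖x‖ = 1 ∧ r = ‖inner ℂ (A x) x‖}

/-- The supremum in the definition of the numerical radius is a genuine one. -/
theorem bddAbove_numericalRadius {H : Type*} [NormedAddCommGroup H] [InnerProductSpace ℂ H]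
    (A : H →L[ℂ] H) : BddAbove {r : ℝ | ∃ x : H, ‖x‖ = 1 ∧ r = ‖inner ℂ (A x) x‖} := by
  refine ⟨‖A‖, ?_⟩
  rintro r ⟨x, hx, rfl⟩
  have h1 := norm_inner_le_norm (𝕜 := ℂ) (A x) x
  have h2 := A.le_opNorm x
  rw [hx, mul_one] at h1 h2
  exact h1.trans h2

/-- The quantity `‖A‖ ^ t * ‖(1/2) (|A| ^ (1 - t) + |A*| ^ (1 - t))‖`, where `|A| = (A* A)^(1/2)`,
`|A*| = (A A*)^(1/2)`, and real powers of positive operators are those of the continuous functional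
calculus (so the zeroth power is the identity operator). -/
noncomputable def mixedPowerBound {H : Type*} [NormedAddCommGroup H] [InnerProductSpace ℂ H]
    [CompleteSpace H] (A : H →L[ℂ] H) (t : ℝ) : ℝ :=
  ‖A‖ ^ t * ‖(1 / 2 : ℂ) • (CFC.abs A ^ (1 - t) + CFC.abs (star A) ^ (1 - t))‖

open scoped NNReal

/-! The minimum is attained at `t = 0`. There the bound on `w(A)` follows from the mixed Schwarz
inequality `two_mul_re_inner_le` with `y` a unimodular multiple of `x`. The spectral estimate
`cfcAbs_le_smul_rpow` then shows that `t = 0` is minimal, and the triangle inequality gives the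
bound by `‖A‖`. Mixed Schwarz rests on the intertwining `A|A| = |A*|A` instead of a polar
decomposition. -/

/-- If `q * s + s * p = 0` with `p`, `q` positive, then `star s * s` annihilates `p`. -/
theorem star_mul_self_mul_eq_zero_of_add_eq_zero {R : Type*} [CStarAlgebra R] [PartialOrder R]
    [StarOrderedRing R] {p q s : R} (hp : 0 ≤ p) (hq : 0 ≤ q) (h : q * s + s * p = 0) :
    star s * s * p = 0 := by
  have h1 : star s * s * p = -(star s * q * s) := by
    rw [mul_assoc, eq_neg_of_add_eq_zero_right h, mul_neg, mul_assoc]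
  have hnp : star s * s * p ≤ 0 := by
    rw [h1, neg_nonpos]
    exact star_left_conjugate_nonneg hq s
  have hsa : IsSelfAdjoint (star s * s * p) := by
    rw [h1]
    exact (IsSelfAdjoint.of_nonneg (star_left_conjugate_nonneg hq s)).neg
  have hcomm : Commute (star s * s) p :=
    -- A self-adjoint product of self-adjoint factors forces them to commute, so this product of
    -- positives is also `≥ 0`.
    (IsSelfAdjoint.commute_iff (.star_mul_self s) (.of_nonneg hp)).2 hsa
  exact le_antisymm hnp (hcomm.mul_nonneg (star_mul_self_nonneg s) hp)

/-- Since `a p² = a a* a = q² a`, the defect `s = a p - q a` satisfies `q s + s p = 0`, and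
positivity of `p`, `q` forces `s = 0`. -/
theorem mul_cfcAbs_eq_cfcAbs_star_mul {R : Type*} [CStarAlgebra R] [PartialOrder R]
    [StarOrderedRing R] (a : R) : a * CFC.abs a = CFC.abs (star a) * a := by
  have hp := CFC.abs_nonneg a
  have hq := CFC.abs_nonneg (star a)
  have hpp := CFC.abs_mul_abs a
  have hqq := CFC.abs_mul_abs (star a)
  rw [star_star] at hqq
  generalize CFC.abs a = p at *
  generalize CFC.abs (star a) = q at *
  obtain ⟨s, hs⟩ : ∃ s, s = a * p - q * a := ⟨_, rfl⟩
  have hsum : q * s + s * p = 0 := by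
    have : q * s + s * p = a * (p * p) - q * q * a := by rw [hs]; noncomm_ring
    rw [this, hpp, hqq]; noncomm_ring
  have hcp := star_mul_self_mul_eq_zero_of_add_eq_zero hp hq hsum
  have hpc : p * (star s * s) = 0 := by
    simpa [mul_assoc, (IsSelfAdjoint.of_nonneg hp).star_eq] using congrArg star hcp
  have hsq : star s * q = -(p * star s) := by
    have := congrArg star hsum
    simp only [star_add, star_mul, (IsSelfAdjoint.of_nonneg hp).star_eq,
      (IsSelfAdjoint.of_nonneg hq).star_eq, star_zero] at this
    exact eq_neg_of_add_eq_zero_left this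
  have hc : star s * s = star s * a * p + p * (star s * a) := by
    have : star s * s = star s * a * p - star s * q * a := by
      nth_rewrite 2 [hs]; noncomm_ring
    rw [this, hsq]; noncomm_ring
  have hsa : IsSelfAdjoint (star s * s) := .star_mul_self s
  obtain ⟨c, hcs⟩ : ∃ c, c = star s * s := ⟨_, rfl⟩
  rw [← hcs] at hcp hpc hc hsa
  -- Each term of `hc` has an outer factor `p`, which `c` kills from either side.
  have hcube : c * c * c = 0 := by
    have : c * c * c = c * (star s * a) * (p * c) + c * p * (star s * a) * c := by
      nth_rewrite 2 [hc]; noncomm_ring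
    rw [this, hpc, hcp]; simp
  have hcc : c * c = 0 := by
    rw [← CStarRing.star_mul_self_eq_zero_iff (c * c), star_mul, hsa.star_eq, ← mul_assoc, hcube,
      zero_mul]
  have hc0 : c = 0 := by
    rw [← CStarRing.star_mul_self_eq_zero_iff c, hsa.star_eq, hcc]
  have hs0 : s = 0 := by
    rw [← CStarRing.star_mul_self_eq_zero_iff s, ← hcs, hc0]
  exact sub_eq_zero.1 (hs ▸ hs0)

/-- On the spectrum `0 ≤ x ≤ ‖a‖`, hence `x = x^t x^(1-t) ≤ ‖a‖^t x^(1-t)`. -/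
theorem cfcAbs_le_smul_rpow {R : Type*} [CStarAlgebra R] [PartialOrder R]
    [StarOrderedRing R] (a : R) {t : ℝ} (h0 : 0 ≤ t) (h1 : t ≤ 1) :
    CFC.abs a ≤ (‖a‖₊ ^ t) • CFC.abs a ^ (1 - t) := by
  rcases subsingleton_or_nontrivial R with _ | _
  · exact (Subsingleton.elim _ _).le
  have hp := CFC.abs_nonneg a
  have hcont : ContinuousOn (fun x : ℝ≥0 => x ^ (1 - t)) (spectrum ℝ≥0 (CFC.abs a)) :=
    (NNReal.continuous_rpow_const (sub_nonneg.2 h1)).continuousOn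
  rw [CFC.rpow_def, ← cfc_smul (‖a‖₊ ^ t) (fun x : ℝ≥0 => x ^ (1 - t)) (CFC.abs a) hcont]
  conv_lhs => rw [← cfc_id' ℝ≥0 (CFC.abs a) hp]
  refine cfc_mono (fun x hx => ?_) continuousOn_id
    (hcont.const_smul (‖a‖₊ ^ t))
  have hx' : x ≤ ‖a‖₊ := by
    have := spectrum.algebraMap_mem ℝ hx
    have h2 := spectrum.norm_le_norm_mul_of_mem this
    simpa [CFC.norm_abs, ← NNReal.coe_le_coe] using h2
  calc x = x ^ t * x ^ (1 - t) := by
        rw [← NNReal.rpow_add_of_nonneg _ h0 (sub_nonneg.2 h1)]; simp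
    _ ≤ ‖a‖₊ ^ t * x ^ (1 - t) := by gcongr

theorem norm_cfcAbs_rpow_le {R : Type*} [CStarAlgebra R] [PartialOrder R]
    [StarOrderedRing R] (a : R) {s : ℝ} (hs : 0 ≤ s) : ‖CFC.abs a ^ s‖ ≤ ‖a‖ ^ s := by
  rcases hs.eq_or_lt with rfl | hs
  · rw [CFC.rpow_zero _ (CFC.abs_nonneg a), Real.rpow_zero]
    nontriviality R
    simp
  · rw [CFC.norm_rpow _ hs (CFC.abs_nonneg a), CFC.norm_abs]

section Operator

variable {H : Type*} [NormedAddCommGroup H] [InnerProductSpace ℂ H] [CompleteSpace H]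

open ContinuousLinearMap

/-- Formally, take `z = A* Q⁻¹ y`: intertwining gives `P z = A* y`, and expanding `⟨P(x - z), x - z⟩
≥ 0` yields the claim. Replacing `Q` by `Q + ε` makes it invertible, at a cost of at most `ε‖x‖²`.
-/
theorem two_mul_re_inner_le (A : H →L[ℂ] H) (x y : H) :
    2 * (inner ℂ (A x) y).re ≤
      (inner ℂ (CFC.abs A x) x).re + (inner ℂ (CFC.abs (star A) y) y).re := by
  have hP := (nonneg_iff_isPositive _).1 (CFC.abs_nonneg A)
  have hQ := (nonneg_iff_isPositive _).1 (CFC.abs_nonneg (star A))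
  have hint := mul_cfcAbs_eq_cfcAbs_star_mul (star A)
  rw [star_star] at hint
  have hqq := CFC.abs_mul_abs (star A)
  rw [star_star] at hqq
  have hq0 := CFC.abs_nonneg (star A)
  generalize CFC.abs A = P at *
  generalize CFC.abs (star A) = Q at *
  have key : ∀ ε : ℝ, 0 < ε → 2 * (inner ℂ (A x) y).re ≤
      (inner ℂ (P x) x).re + (inner ℂ (Q y) y).re + ε * ‖x‖ ^ 2 := by
    intro ε hε
    have hunit : IsUnit (Q + algebraMap ℝ (H →L[ℂ] H) ε) := by
      have hε' : IsStrictlyPositive (algebraMap ℝ (H →L[ℂ] H) ε) :=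
        ⟨algebraMap_nonneg _ hε.le, (isUnit_iff_ne_zero.2 hε.ne').map (algebraMap ℝ (H →L[ℂ] H))⟩
      exact (IsStrictlyPositive.nonneg_add hq0 hε').isUnit
    obtain ⟨v, hv⟩ : ∃ v, Q v + (ε : ℂ) • v = y := by
      obtain ⟨u, hu⟩ := hunit
      refine ⟨(↑u⁻¹ : H →L[ℂ] H) y, ?_⟩
      have := congrArg (fun T : H →L[ℂ] H => T y) u.mul_inv
      rw [hu] at this
      simpa [Algebra.algebraMap_eq_smul_one] using this
    obtain ⟨z, hz⟩ : ∃ z, z = star A v := ⟨_, rfl⟩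
    have hPz : P z + (ε : ℂ) • z = star A y := by
      have : star A (Q v) = P (star A v) := congrArg (fun T : H →L[ℂ] H => T v) hint
      rw [hz, ← hv, map_add, map_smul, this]
    have hAz : A z = Q (Q v) := by
      have : Q (Q v) = A (star A v) := congrArg (fun T : H →L[ℂ] H => T v) hqq
      rw [hz, this]
    have hadj : ∀ u w, inner ℂ (star A u) w = inner ℂ u (A w) := fun u w => by
      rw [star_eq_adjoint, adjoint_inner_left]
    have hPz' : P z = star A y - (ε : ℂ) • z := eq_sub_of_add_eq hPz
    have e1 : (inner ℂ (P (x - z)) (x - z)).re = (inner ℂ (P x) x).re - 2 * (inner ℂ (A x) y).re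
        + 2 * ε * (inner ℂ z x).re + (inner ℂ y (A z)).re - ε * ‖z‖ ^ 2 := by
      have h1 : (inner ℂ (A x) y).re = (inner ℂ y (A x)).re := inner_re_symm (𝕜 := ℂ) _ _
      have h2 : (inner ℂ (P x) z).re = (inner ℂ (P z) x).re := by
        rw [hP.inner_left_eq_inner_right]; exact inner_re_symm (𝕜 := ℂ) _ _
      have h3 : (inner ℂ z z).re = ‖z‖ ^ 2 := inner_self_eq_norm_sq (𝕜 := ℂ) z
      rw [map_sub, inner_sub_left, inner_sub_right, inner_sub_right, Complex.sub_re,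
        Complex.sub_re, Complex.sub_re, h2, hPz', inner_sub_left, inner_sub_left, hadj, hadj,
        inner_smul_left, inner_smul_left, Complex.conj_ofReal, Complex.sub_re, Complex.sub_re,
        Complex.re_ofReal_mul, Complex.re_ofReal_mul, h1, h3]
      ring
    have e2 : (inner ℂ (Q y) y).re = (inner ℂ y (A z)).re + ε * ‖Q v‖ ^ 2
        + ε ^ 2 * (inner ℂ (Q v) v).re := by
      have h1 : inner ℂ (Q (Q v)) v = inner ℂ (Q v) (Q v) := hQ.inner_left_eq_inner_right _ _
      have h2 : inner ℂ v (Q (Q v)) = inner ℂ (Q v) (Q v) := (hQ.inner_left_eq_inner_right _ _).symm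
      have h3 : (inner ℂ (Q v) (Q v)).re = ‖Q v‖ ^ 2 := inner_self_eq_norm_sq (𝕜 := ℂ) _
      have h4 : inner ℂ (Q (Q v)) (Q v) = inner ℂ (Q v) (Q (Q v)) :=
        hQ.inner_left_eq_inner_right _ _
      rw [hAz, ← hv, map_add, map_smul]
      simp only [inner_add_left, inner_add_right, inner_smul_left, inner_smul_right,
        Complex.conj_ofReal, Complex.add_re, Complex.re_ofReal_mul, h1, h2, h3, h4]
      ring
    have p1 : 0 ≤ (inner ℂ (P (x - z)) (x - z)).re := hP.re_inner_nonneg_left _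
    have p2 : 0 ≤ (inner ℂ (Q v) v).re := hQ.re_inner_nonneg_left _
    -- Absorbs the cross term `2ε Re⟨z, x⟩ - ε‖z‖²` of `e1` into `ε‖x‖²`.
    have p3 : 0 ≤ ‖x‖ ^ 2 - 2 * (inner ℂ z x).re + ‖z‖ ^ 2 := by
      have h1 : ‖z - x‖ ^ 2 = ‖z‖ ^ 2 - 2 * (inner ℂ z x).re + ‖x‖ ^ 2 :=
        norm_sub_sq (𝕜 := ℂ) z x
      nlinarith [sq_nonneg ‖z - x‖]
    have p4 : 0 ≤ ε * ‖Q v‖ ^ 2 + ε ^ 2 * (inner ℂ (Q v) v).re := by positivity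
    linarith [mul_nonneg hε.le p3]
  refine le_of_forall_pos_le_add fun δ hδ => ?_
  have h := key (δ / (‖x‖ ^ 2 + 1)) (by positivity)
  have : δ / (‖x‖ ^ 2 + 1) * ‖x‖ ^ 2 ≤ δ := by
    rw [div_mul_eq_mul_div, div_le_iff₀ (by positivity)]
    nlinarith
  linarith

theorem two_mul_norm_inner_le (A : H →L[ℂ] H) (x : H) :
    2 * ‖inner ℂ (A x) x‖ ≤ (inner ℂ ((CFC.abs A + CFC.abs (star A)) x) x).re := by
  obtain ⟨c, hc, hcx⟩ : ∃ c : ℂ, ‖c‖ = 1 ∧ c * inner ℂ (A x) x = ‖inner ℂ (A x) x‖ := by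
    obtain ⟨c, hc, h⟩ := Complex.exists_norm_eq_mul_self (inner ℂ (A x) x)
    exact ⟨c, hc, h.symm⟩
  have h := two_mul_re_inner_le A x (c • x)
  rw [inner_smul_right, hcx, map_smul, inner_smul_left, inner_smul_right, ← mul_assoc,
    Complex.conj_mul', hc] at h
  simpa using h

theorem numericalRadius_le_mixedPowerBound_zero (A : H →L[ℂ] H) :
    numericalRadius A ≤ mixedPowerBound A 0 := by
  have h0 : mixedPowerBound A 0 = ‖(1 / 2 : ℂ) • (CFC.abs A + CFC.abs (star A))‖ := by
    simp [mixedPowerBound, CFC.rpow_one]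
  rw [h0]
  refine Real.sSup_le ?_ (norm_nonneg _)
  rintro _ ⟨x, hx, rfl⟩
  have h1 := two_mul_norm_inner_le A x
  have h2 : (inner ℂ ((CFC.abs A + CFC.abs (star A)) x) x).re ≤ ‖CFC.abs A + CFC.abs (star A)‖ := by
    have h3 := norm_inner_le_norm (𝕜 := ℂ) ((CFC.abs A + CFC.abs (star A)) x) x
    have h4 := (CFC.abs A + CFC.abs (star A)).le_opNorm x
    rw [hx, mul_one] at h3 h4
    exact (Complex.re_le_norm _).trans (h3.trans h4)
  rw [norm_smul]
  norm_num
  linarith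

theorem mixedPowerBound_zero_le (A : H →L[ℂ] H) {t : ℝ} (ht : t ∈ Set.Icc (0 : ℝ) 1) :
    mixedPowerBound A 0 ≤ mixedPowerBound A t := by
  have hle : CFC.abs A + CFC.abs (star A) ≤
      (‖A‖₊ ^ t) • (CFC.abs A ^ (1 - t) + CFC.abs (star A) ^ (1 - t)) := by
    rw [smul_add]
    refine add_le_add (cfcAbs_le_smul_rpow A ht.1 ht.2) ?_
    simpa using cfcAbs_le_smul_rpow (star A) ht.1 ht.2
  have h := CStarAlgebra.norm_le_norm_of_nonneg_of_le
    (add_nonneg (CFC.abs_nonneg A) (CFC.abs_nonneg (star A))) hle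
  rw [NNReal.smul_def, norm_smul] at h
  simp only [mixedPowerBound, Real.rpow_zero, sub_zero, one_mul, norm_smul,
    CFC.rpow_one (CFC.abs A) (CFC.abs_nonneg A),
    CFC.rpow_one (CFC.abs (star A)) (CFC.abs_nonneg (star A))]
  rw [mul_left_comm]
  refine mul_le_mul_of_nonneg_left (h.trans_eq ?_) (norm_nonneg _)
  rw [Real.norm_of_nonneg (NNReal.coe_nonneg _), NNReal.coe_rpow, coe_nnnorm]

theorem mixedPowerBound_le_norm (A : H →L[ℂ] H) {t : ℝ} (ht : t ∈ Set.Icc (0 : ℝ) 1) :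
    mixedPowerBound A t ≤ ‖A‖ := by
  have h1 := norm_cfcAbs_rpow_le A (sub_nonneg.2 ht.2)
  have h2 := norm_cfcAbs_rpow_le (star A) (sub_nonneg.2 ht.2)
  rw [norm_star] at h2
  have h3 : ‖(1 / 2 : ℂ) • (CFC.abs A ^ (1 - t) + CFC.abs (star A) ^ (1 - t))‖ ≤
      ‖A‖ ^ (1 - t) := by
    have h4 := norm_add_le (CFC.abs A ^ (1 - t)) (CFC.abs (star A) ^ (1 - t))
    rw [norm_smul]
    norm_num
    linarith
  calc mixedPowerBound A t ≤ ‖A‖ ^ t * ‖A‖ ^ (1 - t) := by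
        unfold mixedPowerBound; gcongr
    _ = ‖A‖ := by
        rw [← Real.rpow_add_of_nonneg (norm_nonneg A) ht.1 (sub_nonneg.2 ht.2)]; simp

end Operator

theorem proposition2p19 {H : Type*} [NormedAddCommGroup H] [InnerProductSpace ℂ H]
    [CompleteSpace H] (A : H →L[ℂ] H) :
    (∀ t ∈ Set.Icc (0 : ℝ) 1,
      numericalRadius A ≤ mixedPowerBound A t ∧ mixedPowerBound A t ≤ ‖A‖) ∧
    ∃ m : ℝ, IsLeast (mixedPowerBound A '' Set.Icc (0 : ℝ) 1) m ∧
      numericalRadius A ≤ m ∧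
      m ≤ ‖A‖ ^ (1 / 2 : ℝ) *
        ‖(1 / 2 : ℂ) • (CFC.abs A ^ (1 / 2 : ℝ) + CFC.abs (star A) ^ (1 / 2 : ℝ))‖ := by
  have hw := numericalRadius_le_mixedPowerBound_zero A
  refine ⟨fun t ht => ⟨hw.trans (mixedPowerBound_zero_le A ht), mixedPowerBound_le_norm A ht⟩,
    mixedPowerBound A 0, ⟨⟨0, by simp, rfl⟩, ?_⟩, hw, ?_⟩
  · rintro _ ⟨t, ht, rfl⟩
    exact mixedPowerBound_zero_le A ht
  · have h := mixedPowerBound_zero_le A (t := 1 / 2) (by constructor <;> norm_num)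
    rwa [mixedPowerBound, mixedPowerBound, show (1 : ℝ) - 1 / 2 = 1 / 2 by norm_num,
      ← mixedPowerBound] at h
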